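/- Let $N$ be a lattice of rank $3$ with dual lattice $M=\operatorname{Hom}(N,\mathbb Z)$, and let $u_1,u_2,u_3,u_4\in N$ be such that $\{u_1,u_2,u_3\}$ is a $\mathbb Z$-basis of $N$ and the wall relation $$b_1u_1+b_2u_2+b_3u_3+u_4=0$$ holds, where $b_1,b_2<0<b_3$ are integers. Let $\sigma_0=\operatorname{Cone}(u_1,u_2,u_3,u_4)\subseteq N_{\mathbb R}$, and for each $i$ let $\sigma_i$ be the cone generated by the $u_j$ with $j\neq i$. For a cone $\sigma$ let $U_\sigma=\operatorname{Spec}\mathbb C[\sigma^\vee\cap M]$, and let $U_{31}=U_{\sigma_3}\times_{U_{\sigma_0}}U_{\sigma_1}$ be the scheme-theoretic fiber product. Write $g=\gcd(b_1,b_2)>0$ and $b_i=-g\,b_i'$ for $i=1,2$, and let $\{a\}_b\in\{0,\dots,b-1\}$ denote the remainder of the integer $a$ divided by the positive integer $b$. Then the following statements are equivalent: 1. $U_{31}$ is reduced. 2. For every integer $\lambda$ with $0\le\lambda\le b_1'b_2'$ there exists an integer $y$ with $0\le y\le\lambda/b_1'$ such that $$\{g\lambda\}_{b_3}\ \ge\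 g\cdot\{\lambda-b_1'y\}_{b_2'}.$$ -/

import Mathlib

open CategoryTheory CategoryTheory.Limits AlgebraicGeometry
open scoped TensorProduct

noncomputable section

namespace ToricFlip

variable {N : Type*} [AddCommGroup N]

/-- The real vector space `N_ℝ = ℝ ⊗ N` of a lattice `N`. -/
abbrev RealSpace (N : Type*) [AddCommGroup N] : Type _ := ℝ ⊗[ℤ] N

/-- The cone in `N_ℝ` generated by a set of lattice vectors. -/
def coneOf (s : Set N) : PointedCone ℝ (RealSpace N) :=
  PointedCone.hull ℝ ((fun n : N => (1 : ℝ) ⊗ₜ[ℤ] n) '' s)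

theorem coneOf_mono {s t : Set N} (h : s ⊆ t) : coneOf s ≤ coneOf t :=
  Submodule.span_mono (Set.image_mono h)

/-- The semigroup `S_σ = σ^∨ ∩ M` of the lattice points of the dual cone, for `M = Hom(N, ℤ)`.
Here `Module.Dual.baseChange ℝ m` is the `ℝ`-linear extension of `m` to `N_ℝ`. -/
def dualSemigroup (σ : PointedCone ℝ (RealSpace N)) : AddSubmonoid (Module.Dual ℤ N) where
  carrier := {m | ∀ x ∈ σ, 0 ≤ Module.Dual.baseChange ℝ m x}
  zero_mem' := fun x _ => by simp
  add_mem' := fun {m m'} hm hm' x hx => by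
    rw [map_add, LinearMap.add_apply]
    exact add_nonneg (hm x hx) (hm' x hx)

theorem dualSemigroup_anti {σ τ : PointedCone ℝ (RealSpace N)} (h : σ ≤ τ) :
    dualSemigroup τ ≤ dualSemigroup σ :=
  fun _ hm x hx => hm x (h hx)

/-- The affine toric variety `U_σ = Spec ℂ[S_σ]`. -/
def affineToric (σ : PointedCone ℝ (RealSpace N)) : Scheme :=
  Spec (CommRingCat.of (AddMonoidAlgebra ℂ (dualSemigroup σ)))

/-- The toric morphism `U_σ ⟶ U_τ` of an inclusion of cones `σ ⊆ τ`, induced by the inclusion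
of semigroup algebras `ℂ[S_τ] ⊆ ℂ[S_σ]`. -/
def affineToricMap {σ τ : PointedCone ℝ (RealSpace N)} (h : σ ≤ τ) :
    affineToric σ ⟶ affineToric τ :=
  Spec.map (CommRingCat.ofHom
    (AddMonoidAlgebra.mapDomainRingHom ℂ (AddSubmonoid.inclusion (dualSemigroup_anti h))))

/-- The cone `σ₀` generated by all the vectors of a finite family. -/
def fullCone {k : ℕ} (u : Fin k → N) : PointedCone ℝ (RealSpace N) :=
  coneOf (Set.range u)

/-- The cone `σ_i` generated by all the vectors of the family but the one of index `i`. -/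
def omitCone {k : ℕ} (u : Fin k → N) (i : Fin k) : PointedCone ℝ (RealSpace N) :=
  coneOf (u '' {l | l ≠ i})

theorem omitCone_le_fullCone {k : ℕ} (u : Fin k → N) (i : Fin k) :
    omitCone u i ≤ fullCone u :=
  coneOf_mono (Set.image_subset_range u _)

/-- The scheme-theoretic fiber product `U_{ji} = U_{σ_j} ×_{U_{σ₀}} U_{σ_i}`. -/
def fiberPiece {k : ℕ} (u : Fin k → N) (j i : Fin k) : Scheme :=
  pullback (affineToricMap (omitCone_le_fullCone u j))
    (affineToricMap (omitCone_le_fullCone u i))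

end ToricFlip

end

/-! Evaluation at `u₁, u₂, u₃` gives coordinates `(x, y, z)` on `M`; the wall relation makes
evaluation at `u₄` equal to `w = g(a₁x + a₂y) - bz`, where `aᵢ = bᵢ'` and `b = b₃`. With `S`, `P`,
`Q` the semigroups of `σ₀`, `σ₃`, `σ₁`, the fiber product is the spectrum of `ℂ[P] ⊗_{ℂ[S]} ℂ[Q]`,
spanned by monomials `χ^p ⊗ χ^q`. If each of these depends only on `p + q`, the tensor product
embeds in the domain `ℂ[M]` and is reduced.

Let `e = (0, 0, 1)`, so `-e ∈ P`. Every monomial equals some `χ^{-ke} ⊗ χ^{m+ke}`, so only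
neighbours in `k` need comparison. They agree when some `s ∈ S` has `s + e ∈ S` and can be split off
the `Q`-factor. Such an `s` is found if every floor `⌊gl/b⌋` is reached by some `gμ/b` with `μ ≤ l`
and `μ ∈ ℕa₁ + ℕa₂`, which is `FloorAttained`; `floorAttained_iff` turns this into the remainder
inequality.

Conversely, at the least floor that is not reached (`exists_obstruction`), two neighbours `α`, `β`
of equal degree are separated by a functional, while all products `α^{n-k} β^k` coincide for a
suitable `n`. Then `(α - β)^n = 0` although `α ≠ β`. -/

namespace ToricFlip

/-! ### Monomials in a tensor product of semigroup algebras -/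

section SemigroupTensor

variable {M : Type*} [AddCommGroup M] {S P Q : AddSubmonoid M} (hP : S ≤ P) (hQ : S ≤ Q)
  [Algebra (AddMonoidAlgebra ℂ S) (AddMonoidAlgebra ℂ P)]
  [Algebra (AddMonoidAlgebra ℂ S) (AddMonoidAlgebra ℂ Q)]
  (algP : algebraMap (AddMonoidAlgebra ℂ S) (AddMonoidAlgebra ℂ P) =
    AddMonoidAlgebra.mapDomainRingHom ℂ (AddSubmonoid.inclusion hP))
  (algQ : algebraMap (AddMonoidAlgebra ℂ S) (AddMonoidAlgebra ℂ Q) =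
    AddMonoidAlgebra.mapDomainRingHom ℂ (AddSubmonoid.inclusion hQ))

variable (S P Q) in
open Classical in
/-- The pure tensor `c χ^p ⊗ χ^q`, extended by zero to all lattice points `p` and `q`. -/
noncomputable def monomialTensor (p q : M) (c : ℂ) :
    AddMonoidAlgebra ℂ P ⊗[AddMonoidAlgebra ℂ S] AddMonoidAlgebra ℂ Q :=
  if h : p ∈ P ∧ q ∈ Q then
    AddMonoidAlgebra.single ⟨p, h.1⟩ c ⊗ₜ AddMonoidAlgebra.single ⟨q, h.2⟩ 1
  else 0

theorem monomialTensor_of_mem {p q : M} (hp : p ∈ P) (hq : q ∈ Q) (c : ℂ) :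
    monomialTensor S P Q p q c =
      AddMonoidAlgebra.single ⟨p, hp⟩ c ⊗ₜ AddMonoidAlgebra.single ⟨q, hq⟩ 1 :=
  dif_pos ⟨hp, hq⟩

theorem monomialTensor_add (p q : M) (c d : ℂ) :
    monomialTensor S P Q p q (c + d) =
      monomialTensor S P Q p q c + monomialTensor S P Q p q d := by
  unfold monomialTensor
  split_ifs
  · rw [AddMonoidAlgebra.single_add, TensorProduct.add_tmul]
  · simp

theorem monomialTensor_mul {p q p' q' : M} (hp : p ∈ P) (hq : q ∈ Q) (hp' : p' ∈ P)
    (hq' : q' ∈ Q) (c d : ℂ) :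
    monomialTensor S P Q p q c * monomialTensor S P Q p' q' d =
      monomialTensor S P Q (p + p') (q + q') (c * d) := by
  rw [monomialTensor_of_mem hp hq, monomialTensor_of_mem hp' hq',
    monomialTensor_of_mem (add_mem hp hp') (add_mem hq hq'), Algebra.TensorProduct.tmul_mul_tmul,
    AddMonoidAlgebra.single_mul_single, AddMonoidAlgebra.single_mul_single, one_mul]
  rfl

theorem monomialTensor_pow {p q : M} (hp : p ∈ P) (hq : q ∈ Q) (n : ℕ) :
    monomialTensor S P Q p q 1 ^ n = monomialTensor S P Q (n • p) (n • q) 1 := by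
  induction n with
  | zero =>
    rw [pow_zero, zero_smul, zero_smul, monomialTensor_of_mem (zero_mem P) (zero_mem Q)]
    rfl
  | succ n ih =>
    rw [pow_succ, ih, monomialTensor_mul (nsmul_mem hp n) (nsmul_mem hq n) hp hq, succ_nsmul,
      succ_nsmul, one_mul]

include algP algQ in
theorem monomialTensor_move {p q s : M} (hp : p ∈ P) (hq : q ∈ Q) (hs : s ∈ S) (c : ℂ) :
    monomialTensor S P Q (p + s) q c = monomialTensor S P Q p (q + s) c := by
  rw [monomialTensor_of_mem (add_mem hp (hP hs)) hq, monomialTensor_of_mem hp (add_mem hq (hQ hs))]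
  have h1 : (AddMonoidAlgebra.single ⟨p + s, add_mem hp (hP hs)⟩ c : AddMonoidAlgebra ℂ P) =
      (AddMonoidAlgebra.single (⟨s, hs⟩ : S) (1 : ℂ)) • AddMonoidAlgebra.single ⟨p, hp⟩ c := by
    rw [Algebra.smul_def, algP]
    simp [AddMonoidAlgebra.mapDomain_single, AddMonoidAlgebra.single_mul_single,
      AddSubmonoid.inclusion, add_comm p s]
  have h2 : (AddMonoidAlgebra.single ⟨q + s, add_mem hq (hQ hs)⟩ 1 : AddMonoidAlgebra ℂ Q) =
      (AddMonoidAlgebra.single (⟨s, hs⟩ : S) (1 : ℂ)) • AddMonoidAlgebra.single ⟨q, hq⟩ 1 := by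
    rw [Algebra.smul_def, algQ]
    simp [AddMonoidAlgebra.mapDomain_single, AddMonoidAlgebra.single_mul_single,
      AddSubmonoid.inclusion, add_comm q s]
  rw [h1, h2, TensorProduct.smul_tmul]

theorem tensor_addMonoidHom_ext {G : Type*} [AddCommMonoid G]
    {f f' : AddMonoidAlgebra ℂ P ⊗[AddMonoidAlgebra ℂ S] AddMonoidAlgebra ℂ Q →+ G}
    (balanced : ∀ (p : P) (q : Q) (c d : ℂ),
      (AddMonoidAlgebra.single p c ⊗ₜ AddMonoidAlgebra.single q d :
        AddMonoidAlgebra ℂ P ⊗[AddMonoidAlgebra ℂ S] AddMonoidAlgebra ℂ Q) =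
      AddMonoidAlgebra.single p (c * d) ⊗ₜ AddMonoidAlgebra.single q 1)
    (h : ∀ p ∈ P, ∀ q ∈ Q, ∀ c, f (monomialTensor S P Q p q c) = f' (monomialTensor S P Q p q c)) :
    f = f' := by
  ext t
  induction t with
  | zero => simp
  | add a b ha hb => simp [ha, hb]
  | tmul a b =>
    induction a using AddMonoidAlgebra.induction_linear with
    | zero => simp
    | add a a' ha ha' => simp [TensorProduct.add_tmul, ha, ha']
    | single p c =>
      induction b using AddMonoidAlgebra.induction_linear with
      | zero => simp
      | add b b' hb hb' => simp [TensorProduct.tmul_add, hb, hb']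
      | single q d =>
        rw [balanced, ← monomialTensor_of_mem p.2 q.2]
        exact h p p.2 q q.2 _

include algP algQ in
theorem single_tmul_single (p : P) (q : Q) (c d : ℂ) :
    (AddMonoidAlgebra.single p c ⊗ₜ AddMonoidAlgebra.single q d :
        AddMonoidAlgebra ℂ P ⊗[AddMonoidAlgebra ℂ S] AddMonoidAlgebra ℂ Q) =
      AddMonoidAlgebra.single p (c * d) ⊗ₜ AddMonoidAlgebra.single q 1 := by
  have h1 : (AddMonoidAlgebra.single p (c * d) : AddMonoidAlgebra ℂ P) =
      (AddMonoidAlgebra.single (0 : S) d) • AddMonoidAlgebra.single p c := by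
    rw [Algebra.smul_def, algP]
    simp [AddMonoidAlgebra.mapDomain_single, AddMonoidAlgebra.single_mul_single, mul_comm]
  have h2 : (AddMonoidAlgebra.single q d : AddMonoidAlgebra ℂ Q) =
      (AddMonoidAlgebra.single (0 : S) d) • AddMonoidAlgebra.single q 1 := by
    rw [Algebra.smul_def, algQ]
    simp [AddMonoidAlgebra.mapDomain_single, AddMonoidAlgebra.single_mul_single]
  rw [h1, h2, TensorProduct.smul_tmul]

include algP algQ in
/-- A function on `P × Q` that is invariant under moving elements of `S` from one factor to the
other induces an additive functional on the tensor product. -/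
theorem exists_functional (φ : M → M → ℂ)
    (hφ : ∀ p ∈ P, ∀ q ∈ Q, ∀ s ∈ S, φ (p + s) q = φ p (q + s)) :
    ∃ F : AddMonoidAlgebra ℂ P ⊗[AddMonoidAlgebra ℂ S] AddMonoidAlgebra ℂ Q →+ ℂ,
      ∀ p ∈ P, ∀ q ∈ Q, ∀ c, F (monomialTensor S P Q p q c) = c * φ p q := by
  let B : AddMonoidAlgebra ℂ P →+ AddMonoidAlgebra ℂ Q →+ ℂ :=
    (Finsupp.liftAddHom fun p : P =>
      { toFun := fun c => (Finsupp.liftAddHom fun q : Q =>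
          AddMonoidHom.mulLeft (c * φ p q)).comp AddMonoidAlgebra.coeffAddEquiv.toAddMonoidHom
        map_zero' := by ext; simp
        map_add' := fun c d => by
          ext
          simp [add_mul] }).comp
      AddMonoidAlgebra.coeffAddEquiv.toAddMonoidHom
  have hB : ∀ (p : P) (q : Q) (c d : ℂ),
      B (AddMonoidAlgebra.single p c) (AddMonoidAlgebra.single q d) = c * φ p q * d := by
    intro p q c d
    simp [B]
  refine ⟨TensorProduct.liftAddHom B ?_, ?_⟩
  · intro r a b
    induction r using AddMonoidAlgebra.induction_linear with
    | zero => simp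
    | add r r' hr hr' => simp [add_smul, hr, hr']
    | single s e =>
      induction a using AddMonoidAlgebra.induction_linear with
      | zero => simp
      | add a a' ha ha' => simp [ha, ha']
      | single p c =>
        induction b using AddMonoidAlgebra.induction_linear with
        | zero => simp
        | add b b' hb hb' => simp [hb, hb']
        | single q d =>
          rw [Algebra.smul_def, Algebra.smul_def, algP, algQ]
          simp only [AddMonoidAlgebra.mapDomainRingHom_apply, AddMonoidAlgebra.mapDomain_single,
            AddMonoidAlgebra.single_mul_single, hB]
          have := hφ p p.2 q q.2 s s.2
          simp only [AddSubmonoid.coe_add, AddSubmonoid.coe_inclusion]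
          rw [add_comm (s : M) p, add_comm (s : M) q, this]
          ring
  · intro p hp q hq c
    rw [monomialTensor_of_mem hp hq, TensorProduct.liftAddHom_tmul, hB, mul_one]

include algP algQ in
/-- If `χ^p ⊗ χ^q` depends only on `p + q`, then the tensor product embeds in the group algebra. -/
theorem isReduced_tensor [UniqueSums M]
    (h : ∀ p ∈ P, ∀ q ∈ Q, ∀ p' ∈ P, ∀ q' ∈ Q, p + q = p' + q' → ∀ c,
      monomialTensor S P Q p q c = monomialTensor S P Q p' q' c) :
    _root_.IsReduced (AddMonoidAlgebra ℂ P ⊗[AddMonoidAlgebra ℂ S] AddMonoidAlgebra ℂ Q) := by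
  classical
  let ι (R : AddSubmonoid M) : AddMonoidAlgebra ℂ R →+* AddMonoidAlgebra ℂ M :=
    AddMonoidAlgebra.mapDomainRingHom ℂ R.subtype
  let _ : Algebra (AddMonoidAlgebra ℂ S) (AddMonoidAlgebra ℂ M) := (ι S).toAlgebra
  have hι : ∀ r, algebraMap (AddMonoidAlgebra ℂ S) (AddMonoidAlgebra ℂ M) r = ι S r := fun _ => rfl
  let fP : AddMonoidAlgebra ℂ P →ₐ[AddMonoidAlgebra ℂ S] AddMonoidAlgebra ℂ M :=
    { ι P with
      commutes' := fun r => by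
        rw [hι, algP]
        exact (DFunLike.congr_fun (AddMonoidAlgebra.mapDomainRingHom_comp (R := ℂ) P.subtype
          (AddSubmonoid.inclusion hP)) r).symm }
  let fQ : AddMonoidAlgebra ℂ Q →ₐ[AddMonoidAlgebra ℂ S] AddMonoidAlgebra ℂ M :=
    { ι Q with
      commutes' := fun r => by
        rw [hι, algQ]
        exact (DFunLike.congr_fun (AddMonoidAlgebra.mapDomainRingHom_comp (R := ℂ) Q.subtype
          (AddSubmonoid.inclusion hQ)) r).symm }
  let Φ := Algebra.TensorProduct.lift fP fQ fun _ _ => Commute.all _ _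
  have hΦ : ∀ p ∈ P, ∀ q ∈ Q, ∀ c,
      Φ (monomialTensor S P Q p q c) = AddMonoidAlgebra.single (p + q) c := by
    intro p hp q hq c
    rw [monomialTensor_of_mem hp hq, Algebra.TensorProduct.lift_tmul]
    change ι P _ * ι Q _ = _
    simp [ι]
  -- The pair chosen for `m` outside `P + Q` is immaterial, since the image of `Φ` is spanned by
  -- degrees in `P + Q`.
  have hsec : ∀ m : M, ∃ pq : M × M, ∀ p ∈ P, ∀ q ∈ Q, p + q = m →
      ∀ c, monomialTensor S P Q pq.1 pq.2 c = monomialTensor S P Q p q c := by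
    intro m
    by_cases hm : ∃ pq : M × M, pq.1 ∈ P ∧ pq.2 ∈ Q ∧ pq.1 + pq.2 = m
    · obtain ⟨pq, h1, h2, h3⟩ := hm
      exact ⟨pq, fun p hp q hq hpq => h _ h1 _ h2 p hp q hq (h3.trans hpq.symm)⟩
    · exact ⟨0, fun p hp q hq hpq => (hm ⟨(p, q), hp, hq, hpq⟩).elim⟩
  choose σ hσ using hsec
  let Ψ : AddMonoidAlgebra ℂ M →+
      AddMonoidAlgebra ℂ P ⊗[AddMonoidAlgebra ℂ S] AddMonoidAlgebra ℂ Q :=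
    (Finsupp.liftAddHom fun m : M =>
      AddMonoidHom.mk' (monomialTensor S P Q (σ m).1 (σ m).2)
        (monomialTensor_add _ _)).comp AddMonoidAlgebra.coeffAddEquiv.toAddMonoidHom
  have hΨ : Ψ.comp (Φ : _ →+* AddMonoidAlgebra ℂ M).toAddMonoidHom = AddMonoidHom.id _ := by
    refine tensor_addMonoidHom_ext (single_tmul_single hP hQ algP algQ) ?_
    intro p hp q hq c
    change Ψ (Φ _) = _
    rw [hΦ p hp q hq]
    refine Eq.trans ?_ (hσ (p + q) p hp q hq rfl c)
    exact (Finsupp.liftAddHom_apply_single _ _ _)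
  have hinj : Function.Injective Φ := by
    intro a b hab
    have ha := DFunLike.congr_fun hΨ a
    have hb := DFunLike.congr_fun hΨ b
    change Ψ (Φ a) = a at ha
    change Ψ (Φ b) = b at hb
    rw [← ha, ← hb, hab]
  exact isReduced_of_injective Φ hinj

end SemigroupTensor

/-! ### Arithmetic of the numerical semigroup -/

/-- Every value of `⌊g l / b⌋` with `l ≥ 0` is attained by `g μ` for some `μ ≤ l` in the numerical
semigroup generated by `a₁` and `a₂`. -/
def FloorAttained (a₁ a₂ g b : ℤ) : Prop :=
  ∀ l : ℤ, 0 ≤ l → ∃ x y : ℤ, 0 ≤ x ∧ 0 ≤ y ∧ a₁ * x + a₂ * y ≤ l ∧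
    b * (g * l / b) ≤ g * (a₁ * x + a₂ * y)

/-- Reduce the first Bézout coefficient modulo `a₂`: it is then less than `a₂`, so `a₁x < a₁a₂ ≤ l`
and the other coefficient is nonnegative. -/
theorem exists_nonneg_combination {a₁ a₂ : ℤ} (h₁ : 0 < a₁) (h₂ : 0 < a₂)
    (hcop : IsCoprime a₁ a₂) {l : ℤ} (hl : a₁ * a₂ ≤ l) :
    ∃ x y : ℤ, 0 ≤ x ∧ 0 ≤ y ∧ a₁ * x + a₂ * y = l := by
  obtain ⟨r, s, hrs⟩ := hcop
  refine ⟨(l * r) % a₂, l * s + a₁ * ((l * r) / a₂), Int.emod_nonneg _ h₂.ne', ?_, ?_⟩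
  · have h := Int.emod_add_mul_ediv (l * r) a₂
    have h' := Int.emod_lt_of_pos (l * r) h₂
    have : a₂ * (l * s + a₁ * ((l * r) / a₂)) = l - a₁ * ((l * r) % a₂) := by
      linear_combination l * hrs + a₁ * h
    by_contra! hneg
    nlinarith
  · linear_combination l * hrs + a₁ * Int.emod_add_mul_ediv (l * r) a₂

/-- For fixed `x` the best `y` is `⌊(l - a₁x)/a₂⌋`, which misses `l` by the remainder of `l - a₁x`
modulo `a₂`. Reaching the floor means that `g` times this gap is at most the remainder of `gl`
modulo `b`. For `l ≥ a₁a₂` the gap can be made zero. The `y` of the right-hand side is the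
coefficient `x` of `FloorAttained`. -/
theorem floorAttained_iff {a₁ a₂ g b : ℤ} (h₁ : 0 < a₁) (h₂ : 0 < a₂) (hg : 0 < g) (hb : 0 < b)
    (hcop : IsCoprime a₁ a₂) :
    FloorAttained a₁ a₂ g b ↔
      ∀ l : ℤ, 0 ≤ l → l ≤ a₁ * a₂ →
        ∃ y : ℤ, 0 ≤ y ∧ (y : ℚ) ≤ (l : ℚ) / (a₁ : ℚ) ∧
          (g * l) % b ≥ g * ((l - a₁ * y) % a₂) := by
  have hle : ∀ y l : ℤ, (y : ℚ) ≤ (l : ℚ) / (a₁ : ℚ) ↔ a₁ * y ≤ l := by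
    intro y l
    rw [le_div_iff₀ (by exact_mod_cast h₁), mul_comm]
    exact_mod_cast Iff.rfl
  simp only [hle]
  constructor
  · intro h l hl _
    obtain ⟨x, y, hx, hy, hxy, hfl⟩ := h l hl
    refine ⟨x, hx, by nlinarith, ?_⟩
    have hmod := Int.emod_add_mul_ediv (g * l) b
    have hr : (l - a₁ * x) % a₂ ≤ l - a₁ * x - a₂ * y := by
      rw [← Int.sub_mul_emod_self_left (l - a₁ * x) a₂ y]
      have h0 : 0 ≤ l - a₁ * x - a₂ * y := by linarith
      have := Int.emod_add_mul_ediv (l - a₁ * x - a₂ * y) a₂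
      have := mul_nonneg h₂.le (Int.ediv_nonneg h0 h₂.le)
      linarith
    nlinarith
  · intro h l hl
    by_cases hl' : l ≤ a₁ * a₂
    · obtain ⟨x, hx, hxl, hmod⟩ := h l hl hl'
      have h1 := Int.emod_add_mul_ediv (g * l) b
      have h2 := Int.emod_add_mul_ediv (l - a₁ * x) a₂
      have h3 := Int.emod_nonneg (l - a₁ * x) h₂.ne'
      refine ⟨x, (l - a₁ * x) / a₂, hx, Int.ediv_nonneg (by linarith) h₂.le, by linarith, ?_⟩
      nlinarith
    · obtain ⟨x, y, hx, hy, hxy⟩ := exists_nonneg_combination h₁ h₂ hcop (not_le.1 hl').le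
      refine ⟨x, y, hx, hy, hxy.le, ?_⟩
      rw [hxy]
      exact Int.mul_ediv_self_le hb.ne'

/-- At the least unattained value `f`, no shift by a multiple of `b` helps either. -/
theorem exists_obstruction {a₁ a₂ g b : ℤ} (hg : 0 < g) (hb : 0 < b)
    (h : ¬ FloorAttained a₁ a₂ g b) :
    ∃ l f : ℤ, 0 ≤ l ∧ 1 ≤ f ∧ b * f ≤ g * l ∧ g * l < b * f + b ∧
      ∀ x y j : ℤ, 0 ≤ x → 0 ≤ y → 0 ≤ j → j ≤ f - 1 → b * (j + 1) ≤ g * (a₁ * x + a₂ * y) →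
        g * (a₁ * x + a₂ * y) ≤ g * l - b * (f - 1 - j) → False := by
  classical
  unfold FloorAttained at h
  push Not at h
  -- Minimality is taken over the floor `n`, not over `l`.
  have hex : ∃ n : ℕ, ∃ l : ℤ, 0 ≤ l ∧ g * l / b = n ∧
      ∀ x y : ℤ, 0 ≤ x → 0 ≤ y → a₁ * x + a₂ * y ≤ l → g * (a₁ * x + a₂ * y) < b * n := by
    obtain ⟨l, hl, hbad⟩ := h
    have h0 : 0 ≤ g * l / b := Int.ediv_nonneg (by positivity) hb.le
    refine ⟨(g * l / b).toNat, l, hl, (Int.toNat_of_nonneg h0).symm, ?_⟩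
    rwa [Int.toNat_of_nonneg h0]
  obtain ⟨l, hl, hf, hbad⟩ := Nat.find_spec hex
  have hmin := fun m => @Nat.find_min _ _ hex m
  generalize Nat.find hex = n at *
  have hlow : b * n ≤ g * l := by rw [← hf]; exact Int.mul_ediv_self_le hb.ne'
  have hupp : g * l < b * n + b := by rw [← hf]; exact Int.lt_mul_ediv_self_add hb
  have hn : 1 ≤ (n : ℤ) := by
    by_contra! h0
    have hn0 : (n : ℤ) = 0 := by omega
    have := hbad 0 0 le_rfl le_rfl (by simpa using hl)
    simp [hn0] at this
  refine ⟨l, n, hl, hn, hlow, hupp, ?_⟩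
  intro x y j hx hy hj hjn h1 h2
  set μ := a₁ * x + a₂ * y with hμ
  have hμl : μ ≤ l := by
    have : b * (n - 1 - j) ≥ 0 := mul_nonneg hb.le (by linarith)
    nlinarith
  -- The complement `l - μ` has a smaller floor, which is reached by some `μ'`; then `μ + μ'` would
  -- reach the floor of `l`.
  have hfl : g * (l - μ) / b = n - 1 - j := by
    have := Int.ediv_emod_unique (a := g * (l - μ)) (b := b) (q := n - 1 - j)
      (r := g * (l - μ) - b * (n - 1 - j)) hb
    exact (this.2 ⟨by ring, by linarith, by linarith⟩).1
  have hlt : (n - 1 - j).toNat < n := by omega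
  have hnot := hmin _ hlt
  push Not at hnot
  obtain ⟨x', y', hx', hy', hle, hge⟩ := hnot (l - μ) (by linarith)
    (by rw [hfl]; exact (Int.toNat_of_nonneg (by linarith)).symm)
  rw [Int.toNat_of_nonneg (by linarith)] at hge
  have := hbad (x + x') (y + y') (by linarith) (by linarith) (by linarith)
  nlinarith

/-! ### Reducedness of the tensor product in wall coordinates -/

section FlipTensor

variable {M : Type*} [AddCommGroup M] {S P Q : AddSubmonoid M} (hP : S ≤ P) (hQ : S ≤ Q)
  [Algebra (AddMonoidAlgebra ℂ S) (AddMonoidAlgebra ℂ P)]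
  [Algebra (AddMonoidAlgebra ℂ S) (AddMonoidAlgebra ℂ Q)]
  (algP : algebraMap (AddMonoidAlgebra ℂ S) (AddMonoidAlgebra ℂ P) =
    AddMonoidAlgebra.mapDomainRingHom ℂ (AddSubmonoid.inclusion hP))
  (algQ : algebraMap (AddMonoidAlgebra ℂ S) (AddMonoidAlgebra ℂ Q) =
    AddMonoidAlgebra.mapDomainRingHom ℂ (AddSubmonoid.inclusion hQ))

-- Both sides equal `χ^{p+s} ⊗ χ^{q-s}`: carry `s` to the left, then `s + e` back to the right.
include algP algQ in
theorem monomialTensor_shift {p q s e : M} (hs : s ∈ S) (hse : s + e ∈ S) (hp : p ∈ P)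
    (hpe : p - e ∈ P) (hqs : q - s ∈ Q) (c : ℂ) :
    monomialTensor S P Q p q c = monomialTensor S P Q (p - e) (q + e) c := by
  have h1 := monomialTensor_move hP hQ algP algQ hp hqs hs c
  have h2 := monomialTensor_move hP hQ algP algQ hpe hqs hse c
  rw [sub_add_cancel] at h1
  rw [← h1, show q + e = q - s + (s + e) by abel, ← h2, show p - e + (s + e) = p + s by abel]

variable (x y z : M →+ ℤ) (a₁ a₂ g b : ℤ)
  (hS : ∀ m, m ∈ S ↔ 0 ≤ x m ∧ 0 ≤ y m ∧ 0 ≤ z m ∧ 0 ≤ g * (a₁ * x m + a₂ * y m) - b * z m)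
  (memP : ∀ m, m ∈ P ↔ 0 ≤ x m ∧ 0 ≤ y m ∧ 0 ≤ g * (a₁ * x m + a₂ * y m) - b * z m)
  (memQ : ∀ m, m ∈ Q ↔ 0 ≤ y m ∧ 0 ≤ z m ∧ 0 ≤ g * (a₁ * x m + a₂ * y m) - b * z m)
  (hex : ∀ i j k : ℤ, ∃ m, x m = i ∧ y m = j ∧ z m = k)
  {e : M} (hxe : x e = 0) (hye : y e = 0) (hze : z e = 1)
  (h₁ : 0 < a₁) (h₂ : 0 < a₂) (hg : 0 < g) (hb : 0 < b)

include memP hxe hye hze hb in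
theorem neg_nsmul_mem (k : ℕ) : -(k • e) ∈ P := by
  rw [memP]
  simp only [map_neg, map_nsmul, hxe, hye, hze]
  simp only [smul_zero, neg_zero, le_refl, mul_zero, add_zero, true_and, nsmul_eq_mul, mul_one]
  have : 0 ≤ b * (k : ℤ) := by positivity
  linarith

include algP algQ hS memQ hex hxe hye hze h₁ h₂ hg hb in
theorem monomialTensor_shift_of_floorAttained (h : FloorAttained a₁ a₂ g b) {p q : M} (hp : p ∈ P)
    (hpe : p - e ∈ P) (hq : q ∈ Q) (hqe : q + e ∈ Q) (c : ℂ) :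
    monomialTensor S P Q p q c = monomialTensor S P Q (p - e) (q + e) c := by
  rw [memQ] at hq hqe
  simp only [map_add, hxe, hye, hze, add_zero] at hqe
  obtain ⟨hyq, hzq, hwq⟩ := hq
  obtain ⟨-, -, hwe⟩ := hqe
  set l := a₁ * x q + a₂ * y q with hl
  have hgl : b * (z q + 1) ≤ g * l := by linarith
  have hl0 : 0 ≤ l := by
    have : 0 ≤ b * (z q + 1) := by positivity
    by_contra! hneg
    nlinarith
  have hfl : z q + 1 ≤ g * l / b := (Int.le_ediv_iff_mul_le hb).2 (by linarith)
  -- The bound `j ≤ y q` keeps `q - s` in `Q`. When `x q < 0` it is automatic, since `a₂j ≤ l < a₂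
  -- y(q)`.
  obtain ⟨i, j, hi, hj, hij, hge⟩ : ∃ i j : ℤ, 0 ≤ i ∧ 0 ≤ j ∧ a₁ * i + a₂ * j ≤ l ∧
      b * (g * l / b) ≤ g * (a₁ * i + a₂ * j) ∧ j ≤ y q := by
    by_cases hx : 0 ≤ x q
    · exact ⟨x q, y q, hx, hyq, le_rfl, Int.mul_ediv_self_le hb.ne', le_rfl⟩
    · obtain ⟨i, j, hi, hj, hij, hge⟩ := h l hl0
      refine ⟨i, j, hi, hj, hij, hge, ?_⟩
      by_contra! hlt
      nlinarith [mul_nonneg h₁.le hi]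
  obtain ⟨hge, hjy⟩ := hge
  obtain ⟨s, hsx, hsy, hsz⟩ := hex i j (z q)
  have hbz : b * (z q + 1) ≤ g * (a₁ * i + a₂ * j) :=
    (mul_le_mul_of_nonneg_left hfl hb.le).trans hge
  have hgij : g * (a₁ * i + a₂ * j) ≤ g * l := mul_le_mul_of_nonneg_left hij hg.le
  refine monomialTensor_shift hP hQ algP algQ (s := s) ?_ ?_ hp hpe ?_ c
  · rw [hS, hsx, hsy, hsz]
    exact ⟨hi, hj, hzq, by linarith⟩
  · rw [hS]
    simp only [map_add, hxe, hye, hze, hsx, hsy, hsz, add_zero]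
    exact ⟨hi, hj, by linarith, by linarith⟩
  · rw [memQ]
    simp only [map_sub, hsx, hsy, hsz]
    refine ⟨by linarith, by linarith, ?_⟩
    have : g * (a₁ * (x q - i) + a₂ * (y q - j)) - b * (z q - z q) =
      g * l - g * (a₁ * i + a₂ * j) := by rw [hl]; ring
    linarith

include algP algQ hS memP memQ hex hxe hye hze h₁ h₂ hg hb in
theorem isReduced_of_floorAttained [UniqueSums M] (h : FloorAttained a₁ a₂ g b) :
    _root_.IsReduced (AddMonoidAlgebra ℂ P ⊗[AddMonoidAlgebra ℂ S] AddMonoidAlgebra ℂ Q) := by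
  have hneg := neg_nsmul_mem x y z a₁ a₂ g b memP hxe hye hze hb
  -- Intermediate terms stay in `Q`: `z` is bounded below at the start of the chain and `w` at its
  -- end.
  have hchain : ∀ (m : M) (c : ℂ) (k d : ℕ), m + k • e ∈ Q → m + (k + d) • e ∈ Q →
      monomialTensor S P Q (-(k • e)) (m + k • e) c =
        monomialTensor S P Q (-((k + d) • e)) (m + (k + d) • e) c := by
    intro m c k d hk
    induction d with
    | zero => intro; rfl
    | succ d ih =>
      intro hkd
      have hmid : m + (k + d) • e ∈ Q := by
        rw [memQ] at hk hkd ⊢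
        simp only [map_add, map_nsmul, hxe, hye, hze, smul_zero, add_zero, nsmul_eq_mul, mul_one]
          at hk hkd ⊢
        push_cast at hk hkd ⊢
        exact ⟨hk.1, by linarith, by linarith⟩
      rw [ih hmid]
      have e1 : -((k + (d + 1)) • e) = -((k + d) • e) - e := by
        rw [← add_assoc, succ_nsmul]; abel
      have e2 : m + (k + (d + 1)) • e = m + (k + d) • e + e := by
        rw [← add_assoc, succ_nsmul]; abel
      rw [e1, e2]
      refine monomialTensor_shift_of_floorAttained hP hQ algP algQ x y z a₁ a₂ g b hS memQ
        hex hxe hye hze h₁ h₂ hg hb h (hneg _) ?_ hmid ?_ c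
      · rw [← e1]; exact hneg _
      · rw [← e2]; exact hkd
  have hnorm : ∀ p ∈ P, ∀ q ∈ Q, ∃ k : ℕ, p + q + k • e ∈ Q ∧ ∀ c,
      monomialTensor S P Q p q c = monomialTensor S P Q (-(k • e)) (p + q + k • e) c := by
    intro p hp q hq
    have hp' := (memP p).1 hp
    -- Raising `z p` to at least zero puts `p + ke` in `S`, so it can move right and leave `-ke`.
    obtain ⟨k, hk⟩ : ∃ k : ℕ, p + k • e ∈ S := by
      refine ⟨(-z p).toNat, ?_⟩
      rw [hS]
      simp only [map_add, map_nsmul, hxe, hye, hze, smul_zero, add_zero, nsmul_eq_mul, mul_one]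
      refine ⟨hp'.1, hp'.2.1, by omega, ?_⟩
      rcases le_total 0 (z p) with hz | hz
      · rw [Int.toNat_of_nonpos (by linarith)]
        simpa using hp'.2.2
      · rw [Int.toNat_of_nonneg (by linarith)]
        have h3 : 0 ≤ g * (a₁ * x p + a₂ * y p) :=
          mul_nonneg hg.le (add_nonneg (mul_nonneg h₁.le hp'.1) (mul_nonneg h₂.le hp'.2.1))
        simpa using h3
    have hpq : p + q + k • e = q + (p + k • e) := by abel
    refine ⟨k, ?_, fun c => ?_⟩
    · rw [hpq]
      exact add_mem hq (hQ hk)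
    · rw [hpq, ← monomialTensor_move hP hQ algP algQ (hneg k) hq hk c]
      congr 1
      abel
  refine isReduced_tensor hP hQ algP algQ ?_
  intro p hp q hq p' hp' q' hq' hpq c
  obtain ⟨k, hk, hk'⟩ := hnorm p hp q hq
  obtain ⟨n, hn, hn'⟩ := hnorm p' hp' q' hq'
  rw [← hpq] at hn hn'
  rw [hk', hn']
  rcases le_total k n with hkn | hkn
  · obtain ⟨d, rfl⟩ := Nat.exists_eq_add_of_le hkn
    exact hchain _ c k d hk hn
  · obtain ⟨d, rfl⟩ := Nat.exists_eq_add_of_le hkn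
    exact (hchain _ c n d hn hk).symm

/-- All mixed products equal `α ^ n`, so the binomial expansion is `α ^ n * (1 - 1) ^ n`. -/
theorem sub_pow_eq_zero_of_mul_pow_eq {R : Type*} [CommRing R] {α β : R} {n : ℕ} (hn : n ≠ 0)
    (h : ∀ k < n, α ^ (n - k) * β ^ k = α ^ (n - (k + 1)) * β ^ (k + 1)) : (α - β) ^ n = 0 := by
  have hall : ∀ k ≤ n, α ^ (n - k) * β ^ k = α ^ n := by
    intro k
    induction k with
    | zero => simp
    | succ k ih => intro hk; rw [← h k hk, ih (by omega)]
  rw [sub_eq_add_neg, add_comm, add_pow]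
  have : ∀ k ∈ Finset.range (n + 1), (-β) ^ k * α ^ (n - k) * (n.choose k : R) =
      α ^ n * ((-1) ^ k * 1 ^ (n - k) * (n.choose k : R)) := by
    intro k hk
    rw [neg_pow, ← hall k (by simpa [Nat.lt_succ_iff] using hk), one_pow]
    ring
  rw [Finset.sum_congr rfl this, ← Finset.mul_sum, ← add_pow]
  simp [hn]

include algP algQ hS memP memQ hex hxe hye hze h₁ h₂ hg hb in
theorem floorAttained_of_isReduced (hcop : IsCoprime a₁ a₂)
    (hred : _root_.IsReduced
      (AddMonoidAlgebra ℂ P ⊗[AddMonoidAlgebra ℂ S] AddMonoidAlgebra ℂ Q)) :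
    FloorAttained a₁ a₂ g b := by
  classical
  by_contra hnot
  obtain ⟨l, f, hl, hf, hlow, hupp, hobs⟩ := exists_obstruction hg hb hnot
  have hneg := neg_nsmul_mem x y z a₁ a₂ g b memP hxe hye hze hb
  -- Only `j` must be nonnegative: `Q` puts no sign condition on `x`.
  obtain ⟨i, j, hj, hij⟩ : ∃ i j : ℤ, 0 ≤ j ∧ a₁ * i + a₂ * j = l := by
    obtain ⟨r, s, hrs⟩ := hcop
    refine ⟨l * r + a₂ * (l * s / a₁), (l * s) % a₁, Int.emod_nonneg _ h₁.ne', ?_⟩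
    linear_combination l * hrs + a₂ * Int.emod_add_mul_ediv (l * s) a₁
  obtain ⟨m, hmx, hmy, hmz⟩ := hex i j (f - 1)
  have hmw : g * (a₁ * x m + a₂ * y m) = g * l := by rw [hmx, hmy, hij]
  have hmQ : m ∈ Q := by
    rw [memQ, hmw, hmy, hmz]
    exact ⟨hj, by linarith, by linarith⟩
  have hmeQ : m + e ∈ Q := by
    rw [memQ]
    simp only [map_add, hxe, hye, hze, add_zero, hmw]
    rw [hmy, hmz]
    exact ⟨hj, by linarith, by linarith⟩
  have heP : -e ∈ P := by simpa using hneg 1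
  set α := monomialTensor S P Q 0 m 1 with hα
  set β := monomialTensor S P Q (-e) (m + e) 1 with hβ
  have hne : α ≠ β := by
    -- The sign of `z p` separates `α` (`z = 0`) from `β` (`z = -1`). A move by `s ∈ S` that changed
    -- this sign would make the coordinates of `p + s` a triple excluded by `hobs`.
    obtain ⟨F, hF⟩ := exists_functional hP hQ algP algQ
      (fun p q => if p + q = m ∧ 0 ≤ z p then 1 else 0) (by
        intro p hp q hq s hs
        have hpP := (memP p).1 hp
        have hqQ := (memQ q).1 hq
        have hsS := (hS s).1 hs
        refine if_congr ?_ rfl rfl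
        rw [add_assoc, add_comm s q]
        refine and_congr_right fun hm => ?_
        rw [map_add]
        refine ⟨fun hps => ?_, fun h => by linarith⟩
        by_contra! hpz
        have hX := congrArg x hm
        have hY := congrArg y hm
        have hZ := congrArg z hm
        simp only [map_add] at hX hY hZ
        have hbz : b * z p ≤ -b := by nlinarith
        have hgp : 0 ≤ g * (a₁ * x p + a₂ * y p) :=
          mul_nonneg hg.le (add_nonneg (mul_nonneg h₁.le hpP.1) (mul_nonneg h₂.le hpP.2.1))
        have hm' : g * (a₁ * (x p + x s) + a₂ * (y p + y s)) +
            g * (a₁ * x q + a₂ * y q) = g * l := by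
          rw [← hmw, ← hX, ← hY]; ring
        have hz' : b * (z p + z s) + b * z q = b * (f - 1) := by rw [← hmz, ← hZ]; ring
        refine hobs (x p + x s) (y p + y s) (z p + z s) (by linarith) (by linarith) hps
          (by linarith) ?_ ?_
        · linarith
        · linarith)
    intro hab
    have h0 := hF 0 (zero_mem P) m hmQ 1
    have h1 := hF (-e) heP (m + e) hmeQ 1
    rw [← hα, hab, hβ, h1] at h0
    simp [hze] at h0
  refine hne (sub_eq_zero.1 ((pow_eq_zero_iff (n := (2 * g * a₁).toNat) ?_).1 ?_))
  · have : 0 < 2 * g * a₁ := by positivity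
    omega
  refine sub_pow_eq_zero_of_mul_pow_eq ?_ ?_
  · have : 0 < 2 * g * a₁ := by positivity
    omega
  intro k hk
  have hga : 0 < g * a₁ := by positivity
  obtain ⟨n, hn⟩ : ∃ n : ℕ, (n : ℤ) = 2 * g * a₁ :=
    ⟨(2 * g * a₁).toNat, Int.toNat_of_nonneg (by positivity)⟩
  rw [← hn, Int.toNat_natCast] at hk ⊢
  have hprod : ∀ k ≤ n, α ^ (n - k) * β ^ k =
      monomialTensor S P Q (-(k • e)) (n • m + k • e) 1 := by
    intro k hk
    rw [hα, hβ, monomialTensor_pow (zero_mem P) hmQ, monomialTensor_pow heP hmeQ,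
      monomialTensor_mul (nsmul_mem (zero_mem P) _) (nsmul_mem hmQ _) (nsmul_mem heP _)
        (nsmul_mem hmeQ _), mul_one]
    congr 1
    · simp
    · rw [nsmul_add, ← add_assoc, ← add_nsmul, Nat.sub_add_cancel hk]
  have e1 : -((k + 1) • e) = -(k • e) - e := by rw [succ_nsmul]; abel
  have e2 : n • m + (k + 1) • e = n • m + k • e + e := by rw [succ_nsmul]; abel
  rw [hprod k hk.le, hprod (k + 1) hk, e1, e2]
  have hpe : -(k • e) - e ∈ P := by rw [← e1]; exact hneg _
  have hkn : (k : ℤ) + 1 ≤ n := by exact_mod_cast hk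
  -- An element `s = (b, 0, t)` works as soon as `t` is small enough on both sides.
  have key : ∀ t : ℤ, 0 ≤ t → t + 1 ≤ g * a₁ → t ≤ n * (f - 1) + k →
      g * a₁ - t ≤ n - k →
      monomialTensor S P Q (-(k • e)) (n • m + k • e) 1 =
        monomialTensor S P Q (-(k • e) - e) (n • m + k • e + e) 1 := by
    intro t ht htg htz htw
    obtain ⟨s, hsx, hsy, hsz⟩ := hex b 0 t
    have hbt : b * (t + 1) ≤ b * (g * a₁) := mul_le_mul_of_nonneg_left htg hb.le
    refine monomialTensor_shift hP hQ algP algQ (s := s) ?_ ?_ (hneg k) hpe ?_ 1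
    · rw [hS, hsx, hsy, hsz]
      exact ⟨hb.le, le_rfl, ht, by linarith⟩
    · rw [hS]
      simp only [map_add, hsx, hsy, hsz, hxe, hye, hze, add_zero]
      exact ⟨hb.le, le_rfl, by linarith, by linarith⟩
    · rw [memQ]
      simp only [map_sub, map_add, map_nsmul, hsx, hsy, hsz, hxe, hye, hze, hmx, hmy, hmz,
        smul_zero, add_zero, nsmul_eq_mul, mul_one, sub_zero]
      refine ⟨by positivity, by linarith, ?_⟩
      have h3 : b * (g * a₁ - t) ≤ b * (n - k) := mul_le_mul_of_nonneg_left htw hb.le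
      have h4 : (n : ℤ) * (b * f) ≤ n * (g * l) := mul_le_mul_of_nonneg_left hlow (by positivity)
      have h5 : g * (a₁ * (n * i - b) + a₂ * (n * j)) = n * (g * l) - b * (g * a₁) := by
        rw [← hij]; ring
      rw [h5]
      linarith
  have hnf : 0 ≤ (n : ℤ) * (f - 1) := mul_nonneg (by positivity) (by linarith)
  -- Splitting off `s` uses `t` of the `z`-slack and `g a₁ - t` of the `w`-slack (in units of `b`),
  -- which are at least `k` and `n - k`. As `n = 2 g a₁`, one of the extreme values of `t` always
  -- fits.
  rcases le_total (g * a₁) (k + 1) with hk' | hk'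
  · exact key (g * a₁ - 1) (by linarith) (by linarith) (by linarith) (by linarith)
  · exact key 0 le_rfl (by linarith) (by linarith) (by linarith)

end FlipTensor

/-! ### From cones and schemes to semigroups and tensor products -/

theorem mem_dualSemigroup_coneOf {N : Type*} [AddCommGroup N] {s : Set N}
    {m : Module.Dual ℤ N} : m ∈ dualSemigroup (coneOf s) ↔ ∀ n ∈ s, 0 ≤ m n := by
  have hval : ∀ n : N, Module.Dual.baseChange ℝ m ((1 : ℝ) ⊗ₜ[ℤ] n) = (m n : ℝ) := by
    intro n
    simp [Module.Dual.baseChange_apply_tmul]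
  constructor
  · intro h n hn
    have := h _ (PointedCone.subset_hull (Set.mem_image_of_mem _ hn))
    rw [hval] at this
    exact_mod_cast this
  · intro h v hv
    induction hv using Submodule.span_induction with
    | mem v hv =>
      obtain ⟨n, hn, rfl⟩ := hv
      rw [hval]
      exact_mod_cast h n hn
    | zero => simp
    | add v v' _ _ hv hv' =>
      rw [map_add]
      exact add_nonneg hv hv'
    | smul c v _ hv =>
      change 0 ≤ Module.Dual.baseChange ℝ m ((c : ℝ) • v)
      rw [map_smul]
      exact mul_nonneg c.2 hv

/-- The fiber product of two affine toric varieties over a third one is the spectrum of the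
tensor product of the semigroup algebras. -/
theorem isReduced_fiberPiece_iff {N : Type*} [AddCommGroup N] {k : ℕ} (u : Fin k → N) (j i : Fin k)
    [Algebra (AddMonoidAlgebra ℂ (dualSemigroup (fullCone u)))
      (AddMonoidAlgebra ℂ (dualSemigroup (omitCone u j)))]
    [Algebra (AddMonoidAlgebra ℂ (dualSemigroup (fullCone u)))
      (AddMonoidAlgebra ℂ (dualSemigroup (omitCone u i)))]
    (hj : algebraMap (AddMonoidAlgebra ℂ (dualSemigroup (fullCone u)))
      (AddMonoidAlgebra ℂ (dualSemigroup (omitCone u j))) =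
      AddMonoidAlgebra.mapDomainRingHom ℂ
        (AddSubmonoid.inclusion (dualSemigroup_anti (omitCone_le_fullCone u j))))
    (hi : algebraMap (AddMonoidAlgebra ℂ (dualSemigroup (fullCone u)))
      (AddMonoidAlgebra ℂ (dualSemigroup (omitCone u i))) =
      AddMonoidAlgebra.mapDomainRingHom ℂ
        (AddSubmonoid.inclusion (dualSemigroup_anti (omitCone_le_fullCone u i)))) :
    IsReduced (fiberPiece u j i) ↔
      _root_.IsReduced (AddMonoidAlgebra ℂ (dualSemigroup (omitCone u j))
        ⊗[AddMonoidAlgebra ℂ (dualSemigroup (fullCone u))]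
          AddMonoidAlgebra ℂ (dualSemigroup (omitCone u i))) := by
  have iso : fiberPiece u j i ≅ Spec (CommRingCat.of
      (AddMonoidAlgebra ℂ (dualSemigroup (omitCone u j))
        ⊗[AddMonoidAlgebra ℂ (dualSemigroup (fullCone u))]
          AddMonoidAlgebra ℂ (dualSemigroup (omitCone u i)))) :=
    pullback.congrHom
      (congrArg (fun f => Spec.map (CommRingCat.ofHom f)) hj.symm)
      (congrArg (fun f => Spec.map (CommRingCat.ofHom f)) hi.symm) ≪≫ pullbackSpecIso _ _ _
  rw [← affine_isReduced_iff (CommRingCat.of _)]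
  exact ⟨fun _ => isReduced_of_isOpenImmersion iso.inv,
    fun _ => isReduced_of_isOpenImmersion iso.hom⟩

end ToricFlip

/-- The vectors `u₁, u₂, u₃, u₄` of the wall relation are `u 0, u 1, u 2, u 3`, so that the piece
`U₃₁` is `fiberPiece u 2 0`. -/
theorem lemma4p4 {N : Type*} [AddCommGroup N] (u : Fin 4 → N)
    (hli : LinearIndependent ℤ ![u 0, u 1, u 2])
    (hspan : Submodule.span ℤ {u 0, u 1, u 2} = ⊤)
    (b₁ b₂ b₃ : ℤ) (hb₁ : b₁ < 0) (hb₂ : b₂ < 0) (hb₃ : 0 < b₃)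
    (hwall : b₁ • u 0 + b₂ • u 1 + b₃ • u 2 + u 3 = 0)
    (g b₁' b₂' : ℤ) (hg : g = Int.gcd b₁ b₂)
    (hb₁' : b₁ = -(g * b₁')) (hb₂' : b₂ = -(g * b₂')) :
    IsReduced (ToricFlip.fiberPiece u 2 0) ↔
      ∀ l : ℤ, 0 ≤ l → l ≤ b₁' * b₂' →
        ∃ y : ℤ, 0 ≤ y ∧ (y : ℚ) ≤ (l : ℚ) / (b₁' : ℚ) ∧
          (g * l) % b₃ ≥ g * ((l - b₁' * y) % b₂') := by
  have hg0 : 0 < g := by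
    rw [hg]
    exact_mod_cast Int.gcd_pos_of_ne_zero_left _ hb₁.ne
  have h₁ : 0 < b₁' := pos_of_mul_pos_right (by linarith : 0 < g * b₁') hg0.le
  have h₂ : 0 < b₂' := pos_of_mul_pos_right (by linarith : 0 < g * b₂') hg0.le
  have hcop : IsCoprime b₁' b₂' := by
    rw [Int.isCoprime_iff_gcd_eq_one]
    have : (g.natAbs : ℤ) * Int.gcd b₁' b₂' = g := by
      rw [← Nat.cast_mul, ← Int.gcd_mul_left, ← Int.gcd_neg, ← Int.neg_gcd, ← hb₁', ← hb₂', ← hg]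
    rw [Int.natAbs_of_nonneg hg0.le] at this
    have := mul_left_cancel₀ hg0.ne' (this.trans (mul_one g).symm)
    exact_mod_cast this
  rw [← ToricFlip.floorAttained_iff h₁ h₂ hg0 hb₃ hcop]
  have hrange : Set.range ![u 0, u 1, u 2] = {u 0, u 1, u 2} := by
    simp only [Matrix.range_cons, Matrix.range_empty, Set.union_empty, Set.singleton_union]
  let B : Module.Basis (Fin 3) ℤ N := Module.Basis.mk hli (by rw [hrange, hspan])
  have hB0 : B 0 = u 0 := by simp [B]
  have hB1 : B 1 = u 1 := by simp [B]
  have hB2 : B 2 = u 2 := by simp [B]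
  let ev (n : N) : Module.Dual ℤ N →+ ℤ := (Module.Dual.eval ℤ N n).toAddMonoidHom
  have hev : ∀ n m, ev n m = m n := fun _ _ => rfl
  have hu3 : ∀ m : Module.Dual ℤ N,
      m (u 3) = g * (b₁' * ev (u 0) m + b₂' * ev (u 1) m) - b₃ * ev (u 2) m := by
    intro m
    have := congrArg m hwall
    simp only [map_add, map_smul, smul_eq_mul, map_zero] at this
    rw [hb₁', hb₂'] at this
    simp only [hev]
    linarith
  have hex : ∀ i j k : ℤ, ∃ m : Module.Dual ℤ N,
      ev (u 0) m = i ∧ ev (u 1) m = j ∧ ev (u 2) m = k := by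
    intro i j k
    refine ⟨B.constr ℤ ![i, j, k], ?_, ?_, ?_⟩
    · rw [hev, ← hB0, B.constr_basis]; rfl
    · rw [hev, ← hB1, B.constr_basis]; rfl
    · rw [hev, ← hB2, B.constr_basis]; rfl
  -- Unique sums, inherited from `ℤ³`, make the group algebra of `M` a domain.
  have : UniqueSums (Module.Dual ℤ N) := by
    refine UniqueSums.of_injective_addHom
      ((B.constr ℤ (M' := ℤ)).symm.toAddEquiv.toAddHom : _ →ₙ+ (Fin 3 → ℤ)) ?_ inferInstance
    exact (B.constr ℤ (M' := ℤ)).symm.injective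
  have hS : ∀ m, m ∈ ToricFlip.dualSemigroup (ToricFlip.fullCone u) ↔
      0 ≤ ev (u 0) m ∧ 0 ≤ ev (u 1) m ∧ 0 ≤ ev (u 2) m ∧
        0 ≤ g * (b₁' * ev (u 0) m + b₂' * ev (u 1) m) - b₃ * ev (u 2) m := by
    intro m
    rw [← hu3, ToricFlip.fullCone, ToricFlip.mem_dualSemigroup_coneOf, Set.forall_mem_range]
    simp [hev, Fin.forall_fin_succ]
  have memP : ∀ m, m ∈ ToricFlip.dualSemigroup (ToricFlip.omitCone u 2) ↔
      0 ≤ ev (u 0) m ∧ 0 ≤ ev (u 1) m ∧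
        0 ≤ g * (b₁' * ev (u 0) m + b₂' * ev (u 1) m) - b₃ * ev (u 2) m := by
    intro m
    rw [← hu3, ToricFlip.omitCone, ToricFlip.mem_dualSemigroup_coneOf, Set.forall_mem_image]
    simp [hev, Fin.forall_fin_succ]
  have memQ : ∀ m, m ∈ ToricFlip.dualSemigroup (ToricFlip.omitCone u 0) ↔
      0 ≤ ev (u 1) m ∧ 0 ≤ ev (u 2) m ∧
        0 ≤ g * (b₁' * ev (u 0) m + b₂' * ev (u 1) m) - b₃ * ev (u 2) m := by
    intro m
    rw [← hu3, ToricFlip.omitCone, ToricFlip.mem_dualSemigroup_coneOf, Set.forall_mem_image]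
    simp [hev, Fin.forall_fin_succ]
  obtain ⟨e, hxe, hye, hze⟩ := hex 0 0 1
  let _ := (AddMonoidAlgebra.mapDomainRingHom ℂ (AddSubmonoid.inclusion
    (ToricFlip.dualSemigroup_anti (ToricFlip.omitCone_le_fullCone u 2)))).toAlgebra
  let _ := (AddMonoidAlgebra.mapDomainRingHom ℂ (AddSubmonoid.inclusion
    (ToricFlip.dualSemigroup_anti (ToricFlip.omitCone_le_fullCone u 0)))).toAlgebra
  rw [ToricFlip.isReduced_fiberPiece_iff u 2 0 rfl rfl]
  exact ⟨ToricFlip.floorAttained_of_isReduced _ _ rfl rfl _ _ _ b₁' b₂' g b₃ hS memP memQ hex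
      hxe hye hze h₁ h₂ hg0 hb₃ hcop,
    ToricFlip.isReduced_of_floorAttained _ _ rfl rfl _ _ _ b₁' b₂' g b₃ hS memP memQ hex
      hxe hye hze h₁ h₂ hg0 hb₃⟩
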